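/- Let $K$ be a field and $k\ge 1$ an integer. Points of $\mathbb{Z}\times\mathbb{Z}$ are written in matrix coordinates. Let $w=(w_s)_{s\in\mathbb{Z}}$ be a bi-infinite word on the letters $x,y$ that is admissible, i.e. each of the two letters occurs infinitely often in both directions, and let $\pi_w=(\pi_s)_{s\in\mathbb{Z}}$ be a path with $\pi_{s+1}=\pi_s-(1,0)$ if $w_s=x$ and $\pi_{s+1}=\pi_s+(0,1)$ if $w_s=y$. The $(k-1)$-fringe of $\pi_w$ is $$\Phi_{k-1}(\pi_w)=\{(i+m,j+m)\;:\;(i,j)\in\pi_w,\ 0\le m<k-1\}.$$ Associate to the points $p$ of $\Phi_{k-1}(\pi_w)$ distinct (independent) commuting variables $x_p$, and let $L=K(x_p : p\in\Phi_{k-1}(\pi_w))$ be the field of rational functions in them. For an array $A=(a_{ij})_{i,j\in\mathbb{Z}}$ over $L$ let $M^{(m)}_{ij}=\det(a_{i+r,j+s})_{0\le r,s<m}$. The array $A$ is an $\mathrm{SL}_k$-tiling if $M_{ij}^{(k)}=1$ for all $i,j\in\mathbb{Z}$; it is tame if, moreover, as a bi-infinite matrix it has rank $k$. The principal minors of order $m$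 of $A$ (relative to $\pi_w$) are the $M_{ij}^{(m)}$ with $(i,j)$ on $\pi_w$. Then there is exactly one tame $\mathrm{SL}_k$-tiling $A=(a_{ij})_{i,j\in\mathbb{Z}}$ with entries in $L$ such that $a_p=x_p$ for all $p\in\Phi_{k-1}(\pi_w)$. Its principal minors of orders $1,\dots,k-1$ are nonzero, and every entry $a_{ij}$, $(i,j)\in\mathbb{Z}\times\mathbb{Z}$, lies in the subsemiring (containing $1$) of $L$ generated by the principal minors of orders $1,\dots,k-1$ and their inverses. -/

import Mathlib

/-- The two letters of the alphabet `{x, y}`. -/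
inductive Letter where
  | x : Letter
  | y : Letter

/-- The step of a path for a letter. In matrix coordinates (the first coordinate points downwards,
the second one to the right) `x` is a step upwards and `y` a step to the right. -/
def Letter.step : Letter → ℤ × ℤ
  | .x => (-1, 0)
  | .y => (0, 1)

/-- `π` is a bi-infinite path whose word of steps is `w`. -/
def IsPathOf (w : ℤ → Letter) (π : ℤ → ℤ × ℤ) : Prop :=
  ∀ s : ℤ, π (s + 1) = π s + (w s).step

/-- A bi-infinite word is admissible if each of the two letters occurs infinitely often
in both directions. -/
def Admissible (w : ℤ → Letter) : Prop :=
  ∀ (c : Letter) (N : ℤ), (∃ s, N ≤ s ∧ w s = c) ∧ (∃ s, s ≤ N ∧ w s = c)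

/-- The `k`-fringe of a path: all `(i + m, j + m)` with `(i, j)` on the path and `0 ≤ m < k`. -/
def fringe (π : ℤ → ℤ × ℤ) (k : ℕ) : Set (ℤ × ℤ) :=
  {p | ∃ (s : ℤ) (m : ℕ), m < k ∧ p = ((π s).1 + m, (π s).2 + m)}

/-- The adjacent `m × m` minor of a bi-infinite array with upper left corner `(i, j)`. -/
def adjMinor {L : Type*} [CommRing L] (A : Matrix ℤ ℤ L) (m : ℕ) (i j : ℤ) : L :=
  (Matrix.of fun a b : Fin m => A (i + (a : ℕ)) (j + (b : ℕ))).det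

/-- `SL_k`-tilings of the plane: all adjacent `k × k` minors are equal to one. -/
def IsSLTiling {L : Type*} [CommRing L] (k : ℕ) (A : Matrix ℤ ℤ L) : Prop :=
  ∀ i j : ℤ, adjMinor A k i j = 1

/-- An `SL_k`-tiling of the plane is tame if, as a bi-infinite matrix, it has rank `k`. -/
def IsTameSLTiling {L : Type*} [CommRing L] (k : ℕ) (A : Matrix ℤ ℤ L) : Prop :=
  IsSLTiling k A ∧ A.eRank = (k : ℕ∞)

/-- The principal minors of order `m`, `1 ≤ m < k`, of `A` relative to the path `π`: the adjacent
minors whose upper left corner lies on the path. -/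
def principalMinors {L : Type*} [CommRing L] (A : Matrix ℤ ℤ L) (π : ℤ → ℤ × ℤ) (k : ℕ) : Set L :=
  {t | ∃ (s : ℤ) (m : ℕ), 1 ≤ m ∧ m < k ∧ t = adjMinor A m (π s).1 (π s).2}

/-- The field of rational functions over `K` in distinct variables indexed by the points of the
`k`-fringe of `π`. -/
abbrev FringeField (K : Type*) [Field K] (π : ℤ → ℤ × ℤ) (k : ℕ) : Type _ :=
  FractionRing (MvPolynomial (fringe π k) K)

/-- The variable attached to a point of the fringe, as a rational function. -/
noncomputable def fringeVar (K : Type*) [Field K] (π : ℤ → ℤ × ℤ) (k : ℕ) (p : fringe π k) :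
    FringeField K π k :=
  algebraMap (MvPolynomial (fringe π k) K) (FringeField K π k) (MvPolynomial.X p)

/-- The array `A` carries at each point of the `k`-fringe of `π` the variable of that point. -/
def ExtendsFringeVars {K : Type*} [Field K] {π : ℤ → ℤ × ℤ} {k : ℕ}
    (A : Matrix ℤ ℤ (FringeField K π k)) : Prop :=
  ∀ p : fringe π k, A p.1.1 p.1.2 = fringeVar K π k p

/-!
Let `D s m` be the minor of order `m` at the point `π s` of the path. For `m < k` this minor only
involves entries of the fringe, so that it is a determinant of distinct variables, hence nonzero
(`ExtendsFringeVars.adjMinor_ne_zero`); moreover `D s 0 = D s k = 1`.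

The `k × k` window at `π s` has a Gauss factorization into a lower and an upper triangular matrix
whose pivots are the quotients `D s (m + 1) / D s m`. A step of the path keeps either the rows or
the columns of the window and shifts the others by one. Hence the factorizations at `π s` and at
`π (s + 1)` differ by a bidiagonal matrix of determinant one, whose entries are Laurent monomials
in the principal minors (`transfer`). Conversely, arbitrary nonzero `D s m` define these matrices;
writing the transfer matrix as `N s * (N (s + 1))⁻¹` yields coordinate systems `N s`, in which the
vectors of the rows and of the columns of the window at `π s` are in triangular position
(`LeadsAt`). Pairing rows with columns gives a tame tiling with the principal minors `D s m`
(`IsPathOf.exists_isTameSLTiling`). Its entry in the row of `π s` and the column of `π r` is, up to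
the factor `D s 1`, the upper left entry of `N s * (N r)⁻¹`, a product of transfer matrices or the
inverse of such a product. The inverse of a transfer matrix has a checkerboard of signs, which
cancel on the diagonal, and so the entry lies in the semiring (`diag_mul_inv_mem`).

The principal minors of orders at most `n` determine an array on the `n`-fringe
(`IsPathOf.eq_of_adjMinor_eq`). For `n = k - 1` this shows that the tiling just constructed extends
the variables. For `n = k`, where the minors of order `k` are all one, it shows that two tame
tilings that extend the variables have the same windows along the path. Since the rank is `k`, these
windows determine the whole array (`IsTameSLTiling.eq_of_window_eq`).
-/

/-! ### Combinatorics of admissible paths -/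

/-- Induction from the next occurrence of the letter `c` back to `s`. -/
theorem Admissible.forward_induction {w : ℤ → Letter} (hw : Admissible w) (c : Letter)
    {Q : ℤ → Prop} (base : ∀ s, w s = c → Q s) (step : ∀ s, w s ≠ c → Q (s + 1) → Q s) (s : ℤ) :
    Q s := by
  obtain ⟨t, hst, ht⟩ := (hw c s).1
  obtain ⟨n, rfl⟩ := Int.le.dest hst
  induction n generalizing s with
  | zero => exact base s (by simpa using ht)
  | succ n ih =>
    by_cases h : w s = c
    · exact base s h
    · refine step s h (ih (s + 1) (by omega) ?_)
      rwa [add_assoc, add_comm 1, ← Nat.cast_succ]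

/-- Induction from the last occurrence of the letter `c` before `s` up to `s`. -/
theorem Admissible.backward_induction {w : ℤ → Letter} (hw : Admissible w) (c : Letter)
    {Q : ℤ → Prop} (base : ∀ s, w s = c → Q (s + 1)) (step : ∀ s, w s ≠ c → Q s → Q (s + 1))
    (s : ℤ) : Q s := by
  obtain ⟨t, hst, ht⟩ := (hw c (s - 1)).2
  obtain ⟨n, hn⟩ := Int.le.dest hst
  induction n generalizing s with
  | zero =>
    obtain rfl : s = t + 1 := by push_cast at hn; omega
    exact base t ht
  | succ n ih =>
    obtain ⟨r, rfl⟩ : ∃ r, s = r + 1 := ⟨s - 1, by ring⟩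
    by_cases h : w r = c
    · exact base r h
    · exact step r h (ih r (by push_cast at hn; omega) (by push_cast at hn; omega))

theorem Letter.ne_y {c : Letter} : c ≠ .y ↔ c = .x := by cases c <;> simp

theorem Letter.ne_x {c : Letter} : c ≠ .x ↔ c = .y := by cases c <;> simp

section Path

variable {w : ℤ → Letter} {π : ℤ → ℤ × ℤ}

theorem IsPathOf.step_x (hπ : IsPathOf w π) {s : ℤ} (h : w s = .x) :
    (π (s + 1)).1 = (π s).1 - 1 ∧ (π (s + 1)).2 = (π s).2 := by
  rw [hπ s, h]; simp [Letter.step, sub_eq_add_neg]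

theorem IsPathOf.step_y (hπ : IsPathOf w π) {s : ℤ} (h : w s = .y) :
    (π (s + 1)).1 = (π s).1 ∧ (π (s + 1)).2 = (π s).2 + 1 := by
  rw [hπ s, h]; simp [Letter.step]

/-- A path moves up or to the right, and it advances by one diagonal at each step. -/
theorem IsPathOf.monotone (hπ : IsPathOf w π) {s t : ℤ} (hst : s ≤ t) :
    (π t).1 ≤ (π s).1 ∧ (π s).2 ≤ (π t).2 ∧ (π t).2 - (π t).1 = (π s).2 - (π s).1 + (t - s) := by
  obtain ⟨n, rfl⟩ := Int.le.dest hst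
  clear hst
  induction n with
  | zero => simp
  | succ n ih =>
    have e : s + ((n + 1 : ℕ) : ℤ) = s + n + 1 := by push_cast; ring
    rw [e]
    cases h : w (s + n) with
    | x => have := hπ.step_x h; omega
    | y => have := hπ.step_y h; omega

theorem IsPathOf.exists_row (hπ : IsPathOf w π) (hw : Admissible w) (i : ℤ) :
    ∃ s, (π s).1 = i := by
  induction i using Int.inductionOn' (b := (π 0).1) with
  | zero => exact ⟨0, rfl⟩
  | succ i _ ih =>
    obtain ⟨s, rfl⟩ := ih
    refine hw.backward_induction .x (Q := fun s => ∃ t, (π t).1 = (π s).1 + 1) ?_ ?_ s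
    · exact fun s hs => ⟨s, by have := hπ.step_x hs; omega⟩
    · exact fun s hs ⟨t, ht⟩ => ⟨t, by have := hπ.step_y (Letter.ne_x.1 hs); omega⟩
  | pred i _ ih =>
    obtain ⟨s, rfl⟩ := ih
    refine hw.forward_induction .x (Q := fun s => ∃ t, (π t).1 = (π s).1 - 1) ?_ ?_ s
    · exact fun s hs => ⟨s + 1, by have := hπ.step_x hs; omega⟩
    · exact fun s hs ⟨t, ht⟩ => ⟨t, by have := hπ.step_y (Letter.ne_x.1 hs); omega⟩

theorem IsPathOf.exists_col (hπ : IsPathOf w π) (hw : Admissible w) (j : ℤ) :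
    ∃ s, (π s).2 = j := by
  induction j using Int.inductionOn' (b := (π 0).2) with
  | zero => exact ⟨0, rfl⟩
  | succ j _ ih =>
    obtain ⟨s, rfl⟩ := ih
    refine hw.forward_induction .y (Q := fun s => ∃ t, (π t).2 = (π s).2 + 1) ?_ ?_ s
    · exact fun s hs => ⟨s + 1, by have := hπ.step_y hs; omega⟩
    · exact fun s hs ⟨t, ht⟩ => ⟨t, by have := hπ.step_x (Letter.ne_y.1 hs); omega⟩
  | pred j _ ih =>
    obtain ⟨s, rfl⟩ := ih
    refine hw.backward_induction .y (Q := fun s => ∃ t, (π t).2 = (π s).2 - 1) ?_ ?_ s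
    · exact fun s hs => ⟨s, by have := hπ.step_y hs; omega⟩
    · exact fun s hs ⟨t, ht⟩ => ⟨t, by have := hπ.step_x (Letter.ne_y.1 hs); omega⟩

/-- Data along the path that only change at the steps `x` are functions of the row. -/
theorem IsPathOf.exists_eq_comp_row (hπ : IsPathOf w π) (hw : Admissible w) {α : Type*}
    (f : ℤ → α) (hf : ∀ s, w s = .y → f (s + 1) = f s) : ∃ g : ℤ → α, ∀ s, g (π s).1 = f s := by
  have key : ∀ (n : ℕ) (s : ℤ), (π (s + n)).1 = (π s).1 → f (s + n) = f s := by
    intro n s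
    induction n with
    | zero => simp
    | succ n ih =>
      have e : s + ((n + 1 : ℕ) : ℤ) = s + n + 1 := by push_cast; ring
      rw [e]
      intro h
      have h₁ := hπ.monotone (show s ≤ s + n by omega)
      cases hs : w (s + n) with
      | x => have := hπ.step_x hs; omega
      | y => have := hπ.step_y hs; rw [hf _ hs]; exact ih (by omega)
  choose g hg using hπ.exists_row hw
  refine ⟨fun i => f (g i), fun s => ?_⟩
  change f (g _) = f s
  rcases le_total s (g (π s).1) with h | h <;> obtain ⟨n, hn⟩ := Int.le.dest h
  · rw [← hn]; exact key n s (by rw [hn, hg])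
  · conv_rhs => rw [← hn]
    exact (key n _ (by rw [hn, hg])).symm

/-- Data along the path that only change at the steps `y` are functions of the column. -/
theorem IsPathOf.exists_eq_comp_col (hπ : IsPathOf w π) (hw : Admissible w) {α : Type*}
    (f : ℤ → α) (hf : ∀ s, w s = .x → f (s + 1) = f s) : ∃ g : ℤ → α, ∀ s, g (π s).2 = f s := by
  have key : ∀ (n : ℕ) (s : ℤ), (π (s + n)).2 = (π s).2 → f (s + n) = f s := by
    intro n s
    induction n with
    | zero => simp
    | succ n ih =>
      have e : s + ((n + 1 : ℕ) : ℤ) = s + n + 1 := by push_cast; ring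
      rw [e]
      intro h
      have h₁ := hπ.monotone (show s ≤ s + n by omega)
      cases hs : w (s + n) with
      | y => have := hπ.step_y hs; omega
      | x => have := hπ.step_x hs; rw [hf _ hs]; exact ih (by omega)
  choose g hg using hπ.exists_col hw
  refine ⟨fun i => f (g i), fun s => ?_⟩
  change f (g _) = f s
  rcases le_total s (g (π s).2) with h | h <;> obtain ⟨n, hn⟩ := Int.le.dest h
  · rw [← hn]; exact key n s (by rw [hn, hg])
  · conv_rhs => rw [← hn]
    exact (key n _ (by rw [hn, hg])).symm

/-- The entry `(a, b)` of the window at the path point `π s` lies on the diagonal of the path point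
`π (s + b - a)`, at a distance from the path that is smaller than the size of the window. -/
theorem IsPathOf.exists_offset (hπ : IsPathOf w π) (s : ℤ) {m a b : ℕ} (ha : a < m) (hb : b < m) :
    ∃ c < m, (π s).1 + a = (π (s + b - a)).1 + c ∧ (π s).2 + b = (π (s + b - a)).2 + c := by
  refine ⟨((π s).1 + a - (π (s + b - a)).1).toNat, ?_⟩
  rcases le_total (a : ℤ) b with h | h
  · have := hπ.monotone (show s ≤ s + b - a by omega)
    omega
  · have := hπ.monotone (show s + b - a ≤ s by omega)
    omega

end Path

/-! ### Arrays with prescribed principal minors -/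

/-- The `k × k` block of adjacent entries of `A` with upper left corner `(i, j)`. -/
def window {L : Type*} (A : Matrix ℤ ℤ L) (k : ℕ) (i j : ℤ) : Matrix (Fin k) (Fin k) L :=
  Matrix.of fun a b => A (i + (a : ℕ)) (j + (b : ℕ))

theorem det_window {L : Type*} [CommRing L] (A : Matrix ℤ ℤ L) (k : ℕ) (i j : ℤ) :
    (window A k i j).det = adjMinor A k i j := rfl

/-- The determinant is affine in the lower right entry, with slope the complementary minor. -/
theorem Matrix.apply_last_eq_of_det_eq {R : Type*} [CommRing R] [IsDomain R] {m : ℕ}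
    (M N : Matrix (Fin (m + 1)) (Fin (m + 1)) R)
    (h : ∀ a b, ¬(a = Fin.last m ∧ b = Fin.last m) → M a b = N a b) (hdet : M.det = N.det)
    (h₀ : (M.submatrix Fin.castSucc Fin.castSucc).det ≠ 0) :
    M (Fin.last m) (Fin.last m) = N (Fin.last m) (Fin.last m) := by
  have hsub : ∀ b : Fin (m + 1), M.submatrix (Fin.last m).succAbove b.succAbove =
      N.submatrix (Fin.last m).succAbove b.succAbove := by
    intro b
    ext a c
    refine h _ _ fun hh => ?_
    simp [Fin.succAbove_last, Fin.castSucc_ne_last] at hh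
  rw [Matrix.det_succ_row M (Fin.last m), Matrix.det_succ_row N (Fin.last m),
    Fin.sum_univ_castSucc, Fin.sum_univ_castSucc, ← hsub] at hdet
  rw [Finset.sum_congr rfl fun b _ => by
    rw [h (Fin.last m) b.castSucc (by simp [Fin.castSucc_ne_last]), hsub]] at hdet
  have := add_left_cancel hdet
  simp only [Fin.val_last, Fin.succAbove_last] at this
  have h2 := mul_right_cancel₀ h₀ this
  simpa [← two_mul] using h2

/-- An array is determined on the `n`-fringe of an admissible path by its minors of orders at most
`n` at the points of the path, when those of orders less than `n` do not vanish.

The minor of order `m + 1` at `π s` determines the entry at distance `m` from `π s`, once the other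
entries of the window are known. Those of them at the same distance `m` from the path belong to
later path points in the same column and to earlier path points in the same row. The former do not
have earlier path points in their row, the latter do not have later ones in their column: from `π s`
the recursion runs along the column or along the row only, up to the next turn of the path. -/
theorem IsPathOf.eq_of_adjMinor_eq {w : ℤ → Letter} {π : ℤ → ℤ × ℤ} (hπ : IsPathOf w π)
    (hw : Admissible w) {F : Type*} [Field F] {A B : Matrix ℤ ℤ F} {n : ℕ}
    (h : ∀ s, ∀ m ≤ n, adjMinor A m (π s).1 (π s).2 = adjMinor B m (π s).1 (π s).2)
    (h₀ : ∀ s, ∀ m < n, adjMinor A m (π s).1 (π s).2 ≠ 0) {m : ℕ} (hm : m < n) (s : ℤ) :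
    A ((π s).1 + m) ((π s).2 + m) = B ((π s).1 + m) ((π s).2 + m) := by
  induction m using Nat.strong_induction_on generalizing s with
  | _ m ih =>
  have core : ∀ s,
      (∀ t, s < t → (π t).2 = (π s).2 →
        A ((π t).1 + m) ((π t).2 + m) = B ((π t).1 + m) ((π t).2 + m)) →
      (∀ t, t < s → (π t).1 = (π s).1 →
        A ((π t).1 + m) ((π t).2 + m) = B ((π t).1 + m) ((π t).2 + m)) →
      A ((π s).1 + m) ((π s).2 + m) = B ((π s).1 + m) ((π s).2 + m) := by
    intro s hcol hrow
    have := Matrix.apply_last_eq_of_det_eq (window A (m + 1) (π s).1 (π s).2)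
      (window B (m + 1) (π s).1 (π s).2) ?_ (h s (m + 1) hm) (h₀ s m hm)
    · simpa [window] using this
    intro a b hab
    simp only [Fin.ext_iff, Fin.val_last] at hab
    obtain ⟨c, hc, h₁, h₂⟩ := hπ.exists_offset s a.2 b.2
    simp only [window, Matrix.of_apply]
    rw [h₁, h₂]
    rcases Nat.lt_succ_iff_lt_or_eq.1 hc with hc | rfl
    · exact ih c hc (hc.trans hm) _
    rcases lt_trichotomy (a : ℕ) b with hlt | heq | hlt
    · have := hπ.monotone (show s ≤ s + b - a by omega)
      exact hcol _ (by omega) (by omega)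
    · rw [heq] at h₁
      simp only [add_sub_cancel_right] at h₁
      omega
    · have := hπ.monotone (show s + b - a ≤ s by omega)
      exact hrow _ (by omega) (by omega)
  have hcol : ∀ s t, s < t → (π t).2 = (π s).2 →
      A ((π t).1 + m) ((π t).2 + m) = B ((π t).1 + m) ((π t).2 + m) := by
    refine hw.forward_induction .y ?_ ?_
    · intro s hs t hst ht
      have := hπ.step_y hs
      have := hπ.monotone (show s + 1 ≤ t by omega)
      omega
    · intro s hs ih t hst ht
      have hx := hπ.step_x (Letter.ne_y.1 hs)
      rcases (show s + 1 ≤ t by omega).eq_or_lt with rfl | hlt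
      · refine core _ ih fun t hst ht => ?_
        have := hπ.monotone (show t ≤ s by omega)
        omega
      · exact ih t hlt (by omega)
  have hrow : ∀ s t, t < s → (π t).1 = (π s).1 →
      A ((π t).1 + m) ((π t).2 + m) = B ((π t).1 + m) ((π t).2 + m) := by
    refine hw.backward_induction .x ?_ ?_
    · intro s hs t hst ht
      have := hπ.step_x hs
      have := hπ.monotone (show t ≤ s by omega)
      omega
    · intro s hs ih t hst ht
      have hy := hπ.step_y (Letter.ne_x.1 hs)
      rcases (show t ≤ s by omega).eq_or_lt with rfl | hlt
      · exact core _ (hcol _) ih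
      · exact ih t hlt (by omega)
  exact core s (hcol s) (hrow s)

/-! ### Arrays of finite rank -/

theorem Matrix.exists_eq_sum_of_eRank_eq {F : Type*} [Field F] {k : ℕ} {A : Matrix ℤ ℤ F}
    (hA : A.eRank = k) {i j : ℤ} (hdet : (window A k i j).det ≠ 0) :
    ∃ C : Fin k → ℤ → F, ∀ i' j', A i' j' = ∑ b : Fin k, A i' (j + (b : ℕ)) * C b j' := by
  have hrank : Module.rank F (Submodule.span F (Set.range A.col)) = k := by
    simpa [Matrix.eRank, Matrix.cRank] using hA
  have hfin : FiniteDimensional F (Submodule.span F (Set.range A.col)) :=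
    Module.finite_of_rank_eq_nat hrank
  have hli : LinearIndependent F (fun b : Fin k => A.col (j + (b : ℕ))) := by
    refine LinearIndependent.of_comp
      (LinearMap.funLeft F F fun a : Fin k => i + ((a : ℕ) : ℤ)) ?_
    exact Matrix.linearIndependent_cols_of_det_ne_zero hdet
  have hspan : Submodule.span F (Set.range fun b : Fin k => A.col (j + (b : ℕ))) =
      Submodule.span F (Set.range A.col) := by
    refine Submodule.eq_of_le_of_finrank_eq (Submodule.span_mono ?_) ?_
    · rintro _ ⟨b, rfl⟩
      exact ⟨_, rfl⟩
    · rw [finrank_span_eq_card hli, Module.finrank_eq_of_rank_eq hrank, Fintype.card_fin]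
  have hmem : ∀ j', ∃ c : Fin k → F, ∑ b, c b • A.col (j + (b : ℕ)) = A.col j' := by
    intro j'
    have : A.col j' ∈ Submodule.span F (Set.range fun b : Fin k => A.col (j + (b : ℕ))) := by
      rw [hspan]
      exact Submodule.subset_span ⟨j', rfl⟩
    exact (Submodule.mem_span_range_iff_exists_fun F).1 this
  choose c hc using hmem
  refine ⟨fun b j' => c j' b, fun i' j' => ?_⟩
  have := congrFun (hc j') i'
  simp only [Finset.sum_apply, Pi.smul_apply, Matrix.col_apply, smul_eq_mul] at this
  rw [← this]
  exact Finset.sum_congr rfl fun b _ => mul_comm _ _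

/-- In an array of rank `k`, every window is obtained from an invertible one. -/
theorem window_eq_mul_inv_mul {F : Type*} [Field F] {k : ℕ} {A : Matrix ℤ ℤ F}
    (hA : A.eRank = k) {i j : ℤ} (hdet : (window A k i j).det ≠ 0) (i' j' : ℤ) :
    window A k i' j' = window A k i' j * (window A k i j)⁻¹ * window A k i j' := by
  obtain ⟨C, hC⟩ := Matrix.exists_eq_sum_of_eRank_eq hA hdet
  have key : ∀ i', window A k i' j' =
      window A k i' j * Matrix.of fun b c : Fin k => C b (j' + (c : ℕ)) := by
    intro i'
    ext a c
    simp only [window, Matrix.mul_apply, Matrix.of_apply]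
    exact hC _ _
  rw [key i', key i, Matrix.mul_assoc,
    Matrix.nonsing_inv_mul_cancel_left _ _ (isUnit_iff_ne_zero.2 hdet)]

/-- A tame tiling is determined by its windows along an admissible path: the window in the rows of
`π s` and the columns of `π t` is computed from its neighbours by induction on `t`. -/
theorem IsTameSLTiling.eq_of_window_eq {w : ℤ → Letter} {π : ℤ → ℤ × ℤ} (hπ : IsPathOf w π)
    (hw : Admissible w) {F : Type*} [Field F] {k : ℕ} (hk : 1 ≤ k) {A B : Matrix ℤ ℤ F}
    (hA : IsTameSLTiling k A) (hB : IsTameSLTiling k B)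
    (h : ∀ s, window A k (π s).1 (π s).2 = window B k (π s).1 (π s).2) : A = B := by
  have hdA : ∀ i j, (window A k i j).det ≠ 0 := fun i j => by
    rw [det_window, hA.1]; exact one_ne_zero
  have hdB : ∀ i j, (window B k i j).det ≠ 0 := fun i j => by
    rw [det_window, hB.1]; exact one_ne_zero
  have up : ∀ s, window A k (π s).1 (π (s + 1)).2 = window B k (π s).1 (π (s + 1)).2 := by
    intro s
    cases hs : w s with
    | x => rw [(hπ.step_x hs).2]; exact h s
    | y => rw [← (hπ.step_y hs).1]; exact h (s + 1)
  have down : ∀ s, window A k (π (s + 1)).1 (π s).2 = window B k (π (s + 1)).1 (π s).2 := by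
    intro s
    cases hs : w s with
    | x => rw [← (hπ.step_x hs).2]; exact h (s + 1)
    | y => rw [(hπ.step_y hs).1]; exact h s
  have all : ∀ s t, window A k (π s).1 (π t).2 = window B k (π s).1 (π t).2 := by
    intro s t
    induction t using Int.inductionOn' (b := s) with
    | zero => exact h s
    | succ t _ ih =>
      rw [window_eq_mul_inv_mul hA.2 (hdA (π t).1 (π t).2),
        window_eq_mul_inv_mul hB.2 (hdB (π t).1 (π t).2), ih, h, up]
    | pred t _ ih =>
      have hd := down (t - 1)
      rw [sub_add_cancel] at hd
      rw [window_eq_mul_inv_mul hA.2 (hdA (π t).1 (π t).2),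
        window_eq_mul_inv_mul hB.2 (hdB (π t).1 (π t).2), ih, h, hd]
  ext i j
  obtain ⟨s, rfl⟩ := hπ.exists_row hw i
  obtain ⟨t, rfl⟩ := hπ.exists_col hw j
  have := congrFun₂ (all s t) ⟨0, hk⟩ ⟨0, hk⟩
  simpa [window] using this

/-- A product of a matrix with `k` columns and a matrix with `k` rows has rank `k` if some `k × k`
minor of it does not vanish. -/
theorem Matrix.eRank_eq_of_factorization {F : Type*} [Field F] {k : ℕ} {A : Matrix ℤ ℤ F}
    (U : Matrix ℤ (Fin k) F) (V : Matrix (Fin k) ℤ F) (hUV : ∀ i j, A i j = ∑ c, U i c * V c j)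
    {i j : ℤ} (hdet : (window A k i j).det ≠ 0) : A.eRank = k := by
  apply le_antisymm
  · have hle : Submodule.span F (Set.range A.col) ≤ Submodule.span F (Set.range U.col) := by
      rw [Submodule.span_le]
      rintro _ ⟨j, rfl⟩
      refine (Submodule.mem_span_range_iff_exists_fun F).2 ⟨fun c => V c j, ?_⟩
      ext i
      simp [hUV, mul_comm]
    have h1 : A.eRank ≤ U.eRank := by
      exact OrderHom.mono (β := ℕ∞) Cardinal.toENat (Submodule.rank_mono hle)
    refine h1.trans (U.eRank_le_card_width.trans ?_)
    simp
  · have h1 : (window A k i j).eRank ≤ A.eRank :=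
      A.eRank_submatrix_le (fun a : Fin k => i + ((a : ℕ) : ℤ)) (fun a : Fin k => j + ((a : ℕ) : ℤ))
    have h2 : (window A k i j).rank = k := by
      rw [Matrix.rank_of_isUnit _ ((Matrix.isUnit_iff_isUnit_det _).2 (isUnit_iff_ne_zero.2 hdet)),
        Fintype.card_fin]
    rw [← Matrix.eRank_toNat_eq_rank] at h2
    have h3 : ((window A k i j).eRank.toNat : ℕ∞) ≤ (window A k i j).eRank :=
      ENat.natCast_toNat_le_self _
    rw [h2] at h3
    exact h3.trans h1

/-! ### Transfer matrices -/

/-- Every family of group elements indexed by `ℤ` consists of the quotients of consecutive members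
of a family. -/
theorem exists_telescoping {G : Type*} [Group G] (t : ℤ → G) :
    ∃ N : ℤ → G, ∀ s, N s = t s * N (s + 1) := by
  let P : ℕ → G := fun m => Nat.rec 1 (fun m g => (t m)⁻¹ * g) m
  let Q : ℕ → G := fun m => Nat.rec 1 (fun m g => t (Int.negSucc m) * g) m
  refine ⟨fun s => Int.casesOn s P fun m => Q (m + 1), fun s => ?_⟩
  match s with
  | .ofNat m => exact (mul_inv_cancel_left (t m) (P m)).symm
  | .negSucc 0 => rfl
  | .negSucc (m + 1) => rfl

section Transfer

variable {F : Type*} [Field F]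

/-- The `m`-th pivot of a matrix with leading principal minors `D s 0, D s 1, …`. -/
def pivot (D : ℤ → ℕ → F) (s : ℤ) (m : ℕ) : F := D s (m + 1) / D s m

/-- The matrix that relates the triangular factorizations of the windows at two consecutive points
of a path, in terms of the leading principal minors `D s m` of these windows. Each window is
factored into a lower triangular matrix of rows, with the pivots on the diagonal, and a unit upper
triangular matrix of columns; the transfer matrix takes columns from the coordinates at `π (s + 1)`
to those at `π s`, and rows, by multiplication from the right, in the opposite direction. -/
def transfer (w : ℤ → Letter) (D : ℤ → ℕ → F) (k : ℕ) (s : ℤ) : Matrix (Fin k) (Fin k) F :=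
  match w s with
  | .x => Matrix.of fun a b =>
      if a = b then 1 else if (b : ℕ) = a + 1 then pivot D (s + 1) b / pivot D s a else 0
  | .y => Matrix.of fun a b =>
      if a = b then pivot D (s + 1) a / pivot D s a else if (a : ℕ) = b + 1 then 1 else 0

theorem transfer_x {w : ℤ → Letter} {D : ℤ → ℕ → F} {k : ℕ} {s : ℤ} (h : w s = .x) (a b : Fin k) :
    transfer w D k s a b =
      if a = b then 1 else if (b : ℕ) = a + 1 then pivot D (s + 1) b / pivot D s a else 0 := by
  simp [transfer, h]

theorem transfer_y {w : ℤ → Letter} {D : ℤ → ℕ → F} {k : ℕ} {s : ℤ} (h : w s = .y) (a b : Fin k) :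
    transfer w D k s a b =
      if a = b then pivot D (s + 1) a / pivot D s a else if (a : ℕ) = b + 1 then 1 else 0 := by
  simp [transfer, h]

variable {w : ℤ → Letter} {D : ℤ → ℕ → F} {k : ℕ}

theorem pivot_ne_zero (hD : ∀ s m, D s m ≠ 0) (s : ℤ) (m : ℕ) : pivot D s m ≠ 0 :=
  div_ne_zero (hD _ _) (hD _ _)

theorem prod_pivot (hD : ∀ s m, D s m ≠ 0) (hD₀ : ∀ s, D s 0 = 1) (s : ℤ) (m : ℕ) :
    ∏ a : Fin m, pivot D s a = D s m := by
  induction m with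
  | zero => simp [hD₀]
  | succ m ih =>
    rw [Fin.prod_univ_castSucc]
    simp only [Fin.val_castSucc, Fin.val_last]
    rw [ih, pivot, mul_div_cancel₀ _ (hD s m)]

theorem det_transfer (hD : ∀ s m, D s m ≠ 0) (hD₀ : ∀ s, D s 0 = 1) (hDk : ∀ s, D s k = 1)
    (s : ℤ) : (transfer w D k s).det = 1 := by
  cases h : w s with
  | x =>
    rw [Matrix.det_of_isUpperTriangular]
    · exact Finset.prod_eq_one fun a _ => by simp [transfer_x h]
    · intro a b (hab : b < a)
      rw [transfer_x h, if_neg hab.ne', if_neg (by have := Fin.lt_def.1 hab; omega)]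
  | y =>
    rw [Matrix.det_of_isLowerTriangular]
    · simp only [transfer_y h, if_true]
      rw [Finset.prod_div_distrib, prod_pivot hD hD₀, prod_pivot hD hD₀, hDk, hDk, div_one]
    · intro a b hab
      have hab : a < b := hab
      rw [transfer_y h, if_neg hab.ne, if_neg (by have := Fin.lt_def.1 hab; omega)]

/-- The coordinate of `v` in position `m` is `x`, and those in later positions vanish. For `m ≥ k`
there is no condition. -/
def LeadsAt (v : Fin k → F) (m : ℕ) (x : F) : Prop :=
  (∀ c : Fin k, m < c → v c = 0) ∧ ∀ c : Fin k, (c : ℕ) = m → v c = x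

theorem leadsAt_zero_iff {n : ℕ} {v : Fin (n + 1) → F} {x : F} :
    LeadsAt v 0 x ↔ v = Pi.single 0 x := by
  constructor
  · intro h
    ext c
    rcases eq_or_ne c 0 with rfl | hc
    · simpa using h.2 0 rfl
    · rw [Pi.single_eq_of_ne hc]
      exact h.1 c (Fin.pos_iff_ne_zero.2 hc)
  · rintro rfl
    refine ⟨fun c hc => Pi.single_eq_of_ne (Fin.pos_iff_ne_zero.1 hc) _, fun c hc => ?_⟩
    obtain rfl : c = 0 := Fin.ext hc
    simp

theorem LeadsAt.vecMul {v : Fin k → F} {m e : ℕ} {x y : F} (hv : LeadsAt v m x)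
    {T : Matrix (Fin k) (Fin k) F} (hT : ∀ a c : Fin k, (a : ℕ) + e < c → T a c = 0)
    (hy : ∀ a c : Fin k, (a : ℕ) = m → (c : ℕ) = m + e → x * T a c = y) :
    LeadsAt (Matrix.vecMul v T) (m + e) y := by
  constructor
  · intro c hc
    rw [Matrix.vecMul, dotProduct]
    refine Finset.sum_eq_zero fun a _ => ?_
    rcases lt_or_ge m (a : ℕ) with h | h
    · rw [hv.1 a h, zero_mul]
    · rw [hT a c (by omega), mul_zero]
  · intro c hc
    have hm : m < k := by omega
    rw [Matrix.vecMul, dotProduct, Finset.sum_eq_single ⟨m, hm⟩]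
    · rw [hv.2 _ rfl, hy _ _ rfl hc]
    · intro a _ ha
      rcases lt_or_ge m (a : ℕ) with h | h
      · rw [hv.1 a h, zero_mul]
      · have : (a : ℕ) ≠ m := fun h => ha (Fin.ext h)
        rw [hT a c (by omega), mul_zero]
    · simp

theorem LeadsAt.mulVec {v : Fin k → F} {m e : ℕ} {x y : F} (hv : LeadsAt v m x)
    {T : Matrix (Fin k) (Fin k) F} (hT : ∀ a c : Fin k, (a : ℕ) + e < c → T c a = 0)
    (hy : ∀ a c : Fin k, (a : ℕ) = m → (c : ℕ) = m + e → x * T c a = y) :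
    LeadsAt (Matrix.mulVec T v) (m + e) y := by
  rw [← Matrix.vecMul_transpose]
  exact hv.vecMul hT hy

theorem LeadsAt.vecMul_transfer_x (hD : ∀ s m, D s m ≠ 0) {s : ℤ} (h : w s = .x) {v : Fin k → F}
    {m : ℕ} (hv : LeadsAt v m (pivot D s m)) :
    LeadsAt (Matrix.vecMul v (transfer w D k s)) (m + 1) (pivot D (s + 1) (m + 1)) := by
  refine hv.vecMul (fun a c hac => ?_) fun a c ha hc => ?_
  · rw [transfer_x h, if_neg (by rintro rfl; omega), if_neg (by omega)]
  · rw [transfer_x h, if_neg (by rintro rfl; omega), if_pos (by omega), hc, ha,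
      mul_div_cancel₀ _ (pivot_ne_zero hD s m)]

theorem LeadsAt.vecMul_transfer_y (hD : ∀ s m, D s m ≠ 0) {s : ℤ} (h : w s = .y) {v : Fin k → F}
    {m : ℕ} (hv : LeadsAt v m (pivot D s m)) :
    LeadsAt (Matrix.vecMul v (transfer w D k s)) m (pivot D (s + 1) m) := by
  refine hv.vecMul (e := 0) (fun a c hac => ?_) fun a c ha hc => ?_
  · rw [transfer_y h, if_neg (by rintro rfl; omega), if_neg (by omega)]
  · rw [transfer_y h, if_pos (Fin.ext (by omega)), ha, mul_div_cancel₀ _ (pivot_ne_zero hD s m)]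

theorem LeadsAt.mulVec_transfer_x {s : ℤ} (h : w s = .x) {v : Fin k → F} {m : ℕ}
    (hv : LeadsAt v m 1) : LeadsAt (Matrix.mulVec (transfer w D k s) v) m 1 := by
  refine hv.mulVec (e := 0) (fun a c hac => ?_) fun a c ha hc => ?_
  · rw [transfer_x h, if_neg (by rintro rfl; omega), if_neg (by omega)]
  · rw [transfer_x h, if_pos (Fin.ext (by omega)), one_mul]

theorem LeadsAt.mulVec_transfer_y {s : ℤ} (h : w s = .y) {v : Fin k → F} {m : ℕ}
    (hv : LeadsAt v m 1) : LeadsAt (Matrix.mulVec (transfer w D k s) v) (m + 1) 1 := by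
  refine hv.mulVec (fun a c hac => ?_) fun a c ha hc => ?_
  · rw [transfer_y h, if_neg (by rintro rfl; omega), if_neg (by omega)]
  · rw [transfer_y h, if_neg (by rintro rfl; omega), if_pos (by omega), one_mul]

/-- Vectors in triangular position give the leading minors of a Gauss factorization: only the first
`m` coordinates contribute to the `m × m` determinant. -/
theorem det_dotProduct_of_leadsAt {m : ℕ} (hm : m ≤ k) {ρ γ : ℕ → Fin k → F} {x y : ℕ → F}
    (hρ : ∀ a < m, LeadsAt (ρ a) a (x a)) (hγ : ∀ a < m, LeadsAt (γ a) a (y a)) :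
    (Matrix.of fun a b : Fin m => ρ a ⬝ᵥ γ b).det =
      (∏ a : Fin m, x a) * ∏ a : Fin m, y a := by
  have hfac : (Matrix.of fun a b : Fin m => ρ a ⬝ᵥ γ b) =
      (Matrix.of fun a c : Fin m => ρ a (Fin.castLE hm c)) *
        Matrix.of fun c b : Fin m => γ b (Fin.castLE hm c) := by
    ext a b
    simp only [Matrix.of_apply, Matrix.mul_apply, dotProduct]
    refine Eq.trans (Finset.sum_subset (Finset.subset_univ (Finset.univ.map (Fin.castLEEmb hm)))
      fun c _ hc => ?_).symm (Finset.sum_map _ _ _)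
    rcases lt_or_ge (c : ℕ) m with h | h
    · exact absurd (Finset.mem_map.2 ⟨(⟨c, h⟩ : Fin m), Finset.mem_univ _, rfl⟩) hc
    · rw [(hρ a a.2).1 c (by omega), zero_mul]
  rw [hfac, Matrix.det_mul, Matrix.det_of_isLowerTriangular, Matrix.det_of_isUpperTriangular]
  · congr 1
    · exact Finset.prod_congr rfl fun a _ => (hρ a a.2).2 _ rfl
    · exact Finset.prod_congr rfl fun a _ => (hγ a a.2).2 _ rfl
  · intro a b hab
    exact (hγ b b.2).1 _ hab
  · intro a b hab
    have hab : a < b := hab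
    exact (hρ a a.2).1 _ hab

end Transfer

/-! ### Positivity of products of transfer matrices -/

section Positivity

variable {F : Type*} [Field F] {k : ℕ} {P : Subsemiring F}

/-- The entries of `M` lie in the subsemiring `P` up to the signs of a checkerboard. -/
def Checkerboard (P : Subsemiring F) (M : Matrix (Fin k) (Fin k) F) : Prop :=
  ∀ a b : Fin k, (-1) ^ (a + b : ℕ) * M a b ∈ P

theorem Checkerboard.one : Checkerboard P (1 : Matrix (Fin k) (Fin k) F) := by
  intro a b
  rcases eq_or_ne a b with rfl | h
  · simp [← two_mul]
  · simp [Matrix.one_apply_ne h]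

theorem Checkerboard.mul {M N : Matrix (Fin k) (Fin k) F} (hM : Checkerboard P M)
    (hN : Checkerboard P N) : Checkerboard P (M * N) := by
  intro a b
  rw [Matrix.mul_apply, Finset.mul_sum]
  refine sum_mem fun c _ => ?_
  have h : (-1 : F) ^ (a + b : ℕ) = (-1) ^ (a + c : ℕ) * (-1) ^ (c + b : ℕ) := by
    rw [← pow_add, show (a + c + (c + b) : ℕ) = 2 * c + (a + b) by ring, pow_add _ (2 * (c : ℕ)),
      pow_mul, neg_one_sq, one_pow, one_mul]
  rw [h, mul_mul_mul_comm]
  exact mul_mem (hM a c) (hN c b)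

/-- A triangular matrix over `P` whose entries off the diagonal sit in odd positions, and whose
diagonal is invertible in `P`, has an inverse over `P` up to the signs of a checkerboard. The
function `f` records the order in which the matrix is triangular. -/
theorem Checkerboard.of_mul_eq_one {M Y : Matrix (Fin k) (Fin k) F} (hMY : M * Y = 1)
    (f : Fin k → ℕ) (hdiag : ∀ a, M a a ≠ 0) (hinv : ∀ a, (M a a)⁻¹ ∈ P) (hM : ∀ a c, M a c ∈ P)
    (hoff : ∀ a c, a ≠ c → M a c ≠ 0 → f c < f a ∧ Odd (a + c : ℕ)) : Checkerboard P Y := by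
  intro a b
  induction hf : f a using Nat.strong_induction_on generalizing a with
  | _ d ih =>
  subst hf
  have hab : ∑ c, M a c * Y c b = (1 : Matrix (Fin k) (Fin k) F) a b := by
    rw [← hMY, Matrix.mul_apply]
  rw [← Finset.add_sum_erase _ _ (Finset.mem_univ a)] at hab
  have hsol : (-1 : F) ^ (a + b : ℕ) * Y a b = (M a a)⁻¹ *
      ((-1) ^ (a + b : ℕ) * (1 : Matrix (Fin k) (Fin k) F) a b +
        ∑ c ∈ Finset.univ.erase a, -(-1) ^ (a + b : ℕ) * (M a c * Y c b)) := by
    rw [← Finset.mul_sum, ← hab]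
    field_simp [hdiag a]
    ring
  rw [hsol]
  refine mul_mem (hinv a) (add_mem (Checkerboard.one a b) (sum_mem fun c hc => ?_))
  rcases eq_or_ne (M a c) 0 with h | h
  · simp [h]
  obtain ⟨hlt, hodd⟩ := hoff a c (Finset.ne_of_mem_erase hc).symm h
  have hsign : -(-1 : F) ^ (a + b : ℕ) = (-1) ^ (c + b : ℕ) := by
    have h1 : (-1 : F) ^ (a + c : ℕ) = -1 := hodd.neg_one_pow
    calc -(-1 : F) ^ (a + b : ℕ) = (-1) ^ (a + c : ℕ) * (-1) ^ (a + b : ℕ) := by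
          rw [h1, neg_one_mul]
      _ = (-1) ^ (c + b : ℕ) := by
        rw [← pow_add, show (a + c + (a + b) : ℕ) = 2 * a + (c + b) by ring,
          pow_add _ (2 * (a : ℕ)), pow_mul, neg_one_sq, one_pow, one_mul]
  rw [hsign, mul_left_comm]
  exact mul_mem (hM a c) (ih _ hlt c rfl)

variable {w : ℤ → Letter} {D : ℤ → ℕ → F}

theorem pivot_mem (hP : ∀ s m, D s m ∈ P ∧ (D s m)⁻¹ ∈ P) (s : ℤ) (m : ℕ) :
    pivot D s m ∈ P ∧ (pivot D s m)⁻¹ ∈ P := by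
  rw [pivot, inv_div, div_eq_mul_inv, div_eq_mul_inv]
  exact ⟨mul_mem (hP _ _).1 (hP _ _).2, mul_mem (hP _ _).1 (hP _ _).2⟩

theorem pivot_div_mem (hP : ∀ s m, D s m ∈ P ∧ (D s m)⁻¹ ∈ P) (s t : ℤ) (l m : ℕ) :
    pivot D s l / pivot D t m ∈ P := by
  rw [div_eq_mul_inv]
  exact mul_mem (pivot_mem hP _ _).1 (pivot_mem hP _ _).2

theorem transfer_mem (hP : ∀ s m, D s m ∈ P ∧ (D s m)⁻¹ ∈ P) (s : ℤ) (a b : Fin k) :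
    transfer w D k s a b ∈ P := by
  cases h : w s with
  | x =>
    rw [transfer_x h]
    split_ifs
    exacts [one_mem P, pivot_div_mem hP _ _ _ _, zero_mem P]
  | y =>
    rw [transfer_y h]
    split_ifs
    exacts [pivot_div_mem hP _ _ _ _, one_mem P, zero_mem P]

theorem checkerboard_of_transfer_mul_eq_one (hD : ∀ s m, D s m ≠ 0)
    (hP : ∀ s m, D s m ∈ P ∧ (D s m)⁻¹ ∈ P) {s : ℤ} {Y : Matrix (Fin k) (Fin k) F}
    (hY : transfer w D k s * Y = 1) : Checkerboard P Y := by
  cases h : w s with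
  | x =>
    refine Checkerboard.of_mul_eq_one hY (fun a => k - a) (fun a => ?_) (fun a => ?_)
      (transfer_mem hP s) fun a c hac hne => ?_
    · simp [transfer_x h]
    · simp [transfer_x h]
    · rw [transfer_x h, if_neg hac, ite_ne_right_iff] at hne
      exact ⟨by omega, a, by omega⟩
  | y =>
    refine Checkerboard.of_mul_eq_one hY (fun a => a) (fun a => ?_) (fun a => ?_)
      (transfer_mem hP s) fun a c hac hne => ?_
    · rw [transfer_y h, if_pos rfl]
      exact div_ne_zero (pivot_ne_zero hD _ _) (pivot_ne_zero hD _ _)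
    · rw [transfer_y h, if_pos rfl, inv_div]
      exact pivot_div_mem hP _ _ _ _
    · rw [transfer_y h, if_neg hac, ite_ne_right_iff] at hne
      exact ⟨by omega, c, by omega⟩

/-- A diagonal entry of a product of consecutive transfer matrices, or of the inverse of such a
product, lies in any subsemiring that contains the `D s m` and their inverses. In the case of
inverses the checkerboard signs cancel on the diagonal. -/
theorem diag_mul_inv_mem (hD : ∀ s m, D s m ≠ 0) (hP : ∀ s m, D s m ∈ P ∧ (D s m)⁻¹ ∈ P)
    {N : ℤ → Matrix.SpecialLinearGroup (Fin k) F} {t : ℤ → Matrix.SpecialLinearGroup (Fin k) F}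
    (ht : ∀ s, (t s).1 = transfer w D k s) (hN : ∀ s, N s = t s * N (s + 1)) (r s : ℤ)
    (a : Fin k) : (N r * (N s)⁻¹).1 a a ∈ P := by
  rcases le_total r s with h | h <;> obtain ⟨n, rfl⟩ := Int.le.dest h <;> clear h
  · have : (N r * (N (r + n))⁻¹).1 ∈ P.matrix := by
      induction n with
      | zero => simp
      | succ n ih =>
        have e : N r * (N (r + (n + 1 : ℕ)))⁻¹ = N r * (N (r + n))⁻¹ * t (r + n) := by
          rw [hN (r + n)]
          push_cast
          rw [← add_assoc]
          group
        rw [e]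
        refine mul_mem ih ?_
        rw [ht]
        exact fun a b => transfer_mem hP _ a b
    exact this a a
  · have : Checkerboard P (N (s + n) * (N s)⁻¹).1 := by
      induction n with
      | zero => simpa using Checkerboard.one
      | succ n ih =>
        have e : N (s + (n + 1 : ℕ)) * (N s)⁻¹ = (t (s + n))⁻¹ * (N (s + n) * (N s)⁻¹) := by
          rw [hN (s + n)]
          push_cast
          rw [← add_assoc]
          group
        rw [e]
        refine Checkerboard.mul (checkerboard_of_transfer_mul_eq_one hD hP (s := s + n) (w := w) ?_)
          ih
        rw [← ht]
        exact congrArg Subtype.val (mul_inv_cancel (t (s + n)))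
    simpa [← two_mul] using this a a

end Positivity

/-! ### The tame tiling with given principal minors -/

/-- Given nonzero prescribed principal minors `D s m` along an admissible path, with
`D s 0 = D s k = 1`, there is a tame `SL_k`-tiling that realizes them. Its entries lie in every
subsemiring that contains the `D s m` and their inverses. -/
theorem IsPathOf.exists_isTameSLTiling {w : ℤ → Letter} {π : ℤ → ℤ × ℤ} (hπ : IsPathOf w π)
    (hw : Admissible w) {F : Type*} [Field F] {k : ℕ} (hk : 1 ≤ k) {D : ℤ → ℕ → F}
    (hD : ∀ s m, D s m ≠ 0) (hD₀ : ∀ s, D s 0 = 1) (hDk : ∀ s, D s k = 1) :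
    ∃ A : Matrix ℤ ℤ F, IsTameSLTiling k A ∧
      (∀ s, ∀ m ≤ k, adjMinor A m (π s).1 (π s).2 = D s m) ∧
      ∀ P : Subsemiring F, (∀ s m, D s m ∈ P ∧ (D s m)⁻¹ ∈ P) → ∀ i j, A i j ∈ P := by
  obtain ⟨n, rfl⟩ : ∃ n, k = n + 1 := ⟨k - 1, by omega⟩
  let t : ℤ → Matrix.SpecialLinearGroup (Fin (n + 1)) F :=
    fun s => ⟨transfer w D (n + 1) s, det_transfer hD hD₀ hDk s⟩
  obtain ⟨N, hN⟩ := exists_telescoping t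
  have hNt : ∀ s, (N s).1 = transfer w D (n + 1) s * (N (s + 1)).1 := fun s =>
    congrArg Subtype.val (hN s)
  have hNinv : ∀ s, (N (s + 1))⁻¹.1 = (N s)⁻¹.1 * transfer w D (n + 1) s := fun s => by
    have : (N (s + 1))⁻¹ = (N s)⁻¹ * t s := by rw [hN s]; group
    exact congrArg Subtype.val this
  have hinv : ∀ s, (N s)⁻¹.1 * (N s).1 = 1 := fun s =>
    congrArg Subtype.val (inv_mul_cancel (N s))
  have hinv' : ∀ s, (N s).1 * (N s)⁻¹.1 = 1 := fun s =>
    congrArg Subtype.val (mul_inv_cancel (N s))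
  -- `N s` is the coordinate system attached to `π s`: in it, the vector of the row of `π s` is a
  -- multiple of the first basis vector, and the vector of its column is the first basis vector.
  obtain ⟨u, hu⟩ := hπ.exists_eq_comp_row hw
    (fun s => Matrix.vecMul (Pi.single 0 (pivot D s 0)) (N s).1) fun s hs => by
      have h : LeadsAt (Pi.single (0 : Fin (n + 1)) (pivot D s 0)) 0 (pivot D s 0) :=
        leadsAt_zero_iff.2 rfl
      rw [hNt s, ← Matrix.vecMul_vecMul, leadsAt_zero_iff.1 (h.vecMul_transfer_y hD hs)]
  obtain ⟨v, hv⟩ := hπ.exists_eq_comp_col hw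
    (fun s => Matrix.mulVec (N s)⁻¹.1 (Pi.single 0 1)) fun s hs => by
      have h : LeadsAt (Pi.single (0 : Fin (n + 1)) (1 : F)) 0 1 := leadsAt_zero_iff.2 rfl
      rw [hNinv s, ← Matrix.mulVec_mulVec, leadsAt_zero_iff.1 (h.mulVec_transfer_x (D := D) hs)]
  have hρ_succ : ∀ s i, Matrix.vecMul (u i) (N (s + 1))⁻¹.1 =
      Matrix.vecMul (Matrix.vecMul (u i) (N s)⁻¹.1) (transfer w D (n + 1) s) := fun s i => by
    rw [hNinv, Matrix.vecMul_vecMul]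
  have hγ_succ : ∀ s j, Matrix.mulVec (N s).1 (v j) =
      Matrix.mulVec (transfer w D (n + 1) s) (Matrix.mulVec (N (s + 1)).1 (v j)) := fun s j => by
    rw [hNt, Matrix.mulVec_mulVec]
  have hρ : ∀ (m : ℕ) (s : ℤ),
      LeadsAt (Matrix.vecMul (u ((π s).1 + m)) (N s)⁻¹.1) m (pivot D s m) := by
    intro m
    induction m with
    | zero =>
      intro s
      rw [Nat.cast_zero, add_zero, hu, Matrix.vecMul_vecMul, hinv', Matrix.vecMul_one]
      exact leadsAt_zero_iff.2 rfl
    | succ m ih =>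
      refine hw.backward_induction .x (fun s hs => ?_) fun s hs ihs => ?_
      · rw [hρ_succ, (hπ.step_x hs).1,
          show (π s).1 - 1 + ((m + 1 : ℕ) : ℤ) = (π s).1 + m by push_cast; ring]
        exact (ih s).vecMul_transfer_x hD hs
      · rw [hρ_succ, (hπ.step_y (Letter.ne_x.1 hs)).1]
        exact ihs.vecMul_transfer_y hD (Letter.ne_x.1 hs)
  have hγ : ∀ (m : ℕ) (s : ℤ), LeadsAt (Matrix.mulVec (N s).1 (v ((π s).2 + m))) m 1 := by
    intro m
    induction m with
    | zero =>
      intro s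
      rw [Nat.cast_zero, add_zero, hv, Matrix.mulVec_mulVec, hinv', Matrix.one_mulVec]
      exact leadsAt_zero_iff.2 rfl
    | succ m ih =>
      refine hw.forward_induction .y (fun s hs => ?_) fun s hs ihs => ?_
      · rw [hγ_succ, show (π s).2 + ((m + 1 : ℕ) : ℤ) = (π (s + 1)).2 + m by
          rw [(hπ.step_y hs).2]; push_cast; ring]
        exact (ih (s + 1)).mulVec_transfer_y hs
      · rw [hγ_succ, ← (hπ.step_x (Letter.ne_y.1 hs)).2]
        exact ihs.mulVec_transfer_x (Letter.ne_y.1 hs)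
  let A : Matrix ℤ ℤ F := Matrix.of fun i j => u i ⬝ᵥ v j
  have hA : ∀ s r i j, A i j = Matrix.vecMul (u i) (N s)⁻¹.1 ⬝ᵥ
      Matrix.mulVec (N s * (N r)⁻¹).1 (Matrix.mulVec (N r).1 (v j)) := by
    intro s r i j
    change u i ⬝ᵥ v j = _
    rw [Matrix.SpecialLinearGroup.coe_mul, Matrix.dotProduct_mulVec, Matrix.vecMul_vecMul,
      Matrix.dotProduct_mulVec, Matrix.vecMul_vecMul, ← Matrix.mul_assoc, hinv, Matrix.one_mul,
      hinv, Matrix.vecMul_one]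
  have hminor : ∀ s, ∀ m ≤ n + 1, adjMinor A m (π s).1 (π s).2 = D s m := by
    intro s m hm
    rw [← prod_pivot hD hD₀ s m, adjMinor]
    have := det_dotProduct_of_leadsAt hm (fun a _ => hρ a s) fun a _ => hγ a s
    rw [Finset.prod_const_one, mul_one] at this
    rw [← this]
    congr 1
    ext a b
    simp only [Matrix.of_apply]
    rw [hA s s, mul_inv_cancel]
    exact congrArg _ (Matrix.one_mulVec _)
  have hSL : IsSLTiling (n + 1) A := by
    intro i j
    obtain ⟨s, rfl⟩ := hπ.exists_row hw i
    obtain ⟨r, rfl⟩ := hπ.exists_col hw j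
    have hfac : window A (n + 1) (π s).1 (π r).2 =
        (Matrix.of fun a c : Fin (n + 1) =>
          Matrix.vecMul (u ((π s).1 + (a : ℕ))) (N s)⁻¹.1 c) *
        ((N s * (N r)⁻¹).1 * Matrix.of fun c b : Fin (n + 1) =>
          Matrix.mulVec (N r).1 (v ((π r).2 + (b : ℕ))) c) := by
      ext a b
      exact hA s r _ _
    rw [← det_window, hfac, Matrix.det_mul, Matrix.det_mul, (N s * (N r)⁻¹).2, one_mul,
      Matrix.det_of_isLowerTriangular, Matrix.det_of_isUpperTriangular]
    · simp only [Matrix.of_apply, (hρ _ _).2 _ rfl, (hγ _ _).2 _ rfl]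
      rw [prod_pivot hD hD₀, hDk, Finset.prod_const_one, one_mul]
    · intro c b hbc
      exact (hγ b r).1 _ hbc
    · intro a c hac
      have hac : a < c := hac
      exact (hρ a s).1 _ hac
  refine ⟨A, ⟨hSL, ?_⟩, hminor, ?_⟩
  · refine Matrix.eRank_eq_of_factorization (Matrix.of u) (Matrix.of fun c j => v j c)
      (fun i j => rfl) (i := 0) (j := 0) ?_
    rw [det_window, hSL]
    exact one_ne_zero
  · intro P hP i j
    obtain ⟨s, rfl⟩ := hπ.exists_row hw i
    obtain ⟨r, rfl⟩ := hπ.exists_col hw j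
    have h₁ : Matrix.vecMul (u (π s).1) (N s)⁻¹.1 = Pi.single 0 (pivot D s 0) :=
      leadsAt_zero_iff.1 (by simpa only [Nat.cast_zero, add_zero] using hρ 0 s)
    have h₂ : Matrix.mulVec (N r).1 (v (π r).2) = Pi.single 0 1 :=
      leadsAt_zero_iff.1 (by simpa only [Nat.cast_zero, add_zero] using hγ 0 r)
    rw [hA s r, h₁, h₂, single_dotProduct, Matrix.mulVec_single_one]
    exact mul_mem (pivot_mem hP s 0).1 (diag_mul_inv_mem hD hP (fun _ => rfl) hN s r 0)

/-! ### Generic minors on the fringe -/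

/-- A determinant whose entries are distinct variables is nonzero. -/
theorem MvPolynomial.det_of_X_ne_zero {σ R : Type*} [CommRing R] [Nontrivial R] {m : ℕ}
    {f : Fin m → Fin m → σ} (hf : Function.Injective fun p : Fin m × Fin m => f p.1 p.2) :
    (Matrix.of fun a b => (X (f a b) : MvPolynomial σ R)).det ≠ 0 := by
  have h : (Matrix.of fun a b => (X (f a b) : MvPolynomial σ R)) =
      (rename (R := R) fun p : Fin m × Fin m => f p.1 p.2).mapMatrix
        (Matrix.mvPolynomialX (Fin m) (Fin m) R) := by
    ext1 a b
    simp [Matrix.mvPolynomialX]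
  rw [h, ← AlgHom.map_det]
  exact (map_ne_zero_iff _ (rename_injective _ hf)).2 (Matrix.det_mvPolynomialX_ne_zero _ R)

theorem mem_fringe_of_lt {w : ℤ → Letter} {π : ℤ → ℤ × ℤ} (hπ : IsPathOf w π) (s : ℤ)
    {n m a b : ℕ} (hm : m ≤ n) (ha : a < m) (hb : b < m) :
    ((π s).1 + (a : ℤ), (π s).2 + (b : ℤ)) ∈ fringe π n := by
  obtain ⟨c, hc, h₁, h₂⟩ := hπ.exists_offset s ha hb
  exact ⟨_, c, hc.trans_le hm, Prod.ext h₁ h₂⟩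

/-- The principal minors of order at most `n` of an array that extends the variables of the
`n`-fringe are generic determinants. -/
theorem ExtendsFringeVars.adjMinor_ne_zero {K : Type*} [Field K] {w : ℤ → Letter}
    {π : ℤ → ℤ × ℤ} (hπ : IsPathOf w π) {n : ℕ} {A : Matrix ℤ ℤ (FringeField K π n)}
    (hA : ExtendsFringeVars A) (s : ℤ) {m : ℕ} (hm : m ≤ n) :
    adjMinor A m (π s).1 (π s).2 ≠ 0 := by
  let f : Fin m → Fin m → fringe π n := fun a b => ⟨_, mem_fringe_of_lt hπ s hm a.2 b.2⟩
  have hf : Function.Injective fun p : Fin m × Fin m => f p.1 p.2 := by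
    rintro ⟨a, b⟩ ⟨c, d⟩ h
    have h := Prod.ext_iff.1 (Subtype.ext_iff.1 h)
    have h₁ : (π s).1 + ((a : ℕ) : ℤ) = (π s).1 + ((c : ℕ) : ℤ) := h.1
    have h₂ : (π s).2 + ((b : ℕ) : ℤ) = (π s).2 + ((d : ℕ) : ℤ) := h.2
    exact Prod.ext (Fin.ext (by dsimp only; omega)) (Fin.ext (by dsimp only; omega))
  have h : (Matrix.of fun a b : Fin m => A ((π s).1 + (a : ℕ)) ((π s).2 + (b : ℕ))) =
      (algebraMap (MvPolynomial (fringe π n) K) (FringeField K π n)).mapMatrix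
        (Matrix.of fun a b => MvPolynomial.X (f a b)) := by
    ext a b
    exact hA (f a b)
  rw [adjMinor, h, ← RingHom.map_det]
  exact (map_ne_zero_iff _ (IsFractionRing.injective _ _)).2 (MvPolynomial.det_of_X_ne_zero hf)

/-- Two arrays that extend the fringe variables have the same principal minors. -/
theorem ExtendsFringeVars.adjMinor_eq {K : Type*} [Field K] {w : ℤ → Letter}
    {π : ℤ → ℤ × ℤ} (hπ : IsPathOf w π) {n : ℕ} {A B : Matrix ℤ ℤ (FringeField K π n)}
    (hA : ExtendsFringeVars A) (hB : ExtendsFringeVars B) (s : ℤ) {m : ℕ} (hm : m ≤ n) :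
    adjMinor A m (π s).1 (π s).2 = adjMinor B m (π s).1 (π s).2 := by
  rw [adjMinor, adjMinor]
  congr 1
  ext a b
  exact (hA ⟨_, mem_fringe_of_lt hπ s hm a.2 b.2⟩).trans
    (hB ⟨_, mem_fringe_of_lt hπ s hm a.2 b.2⟩).symm

theorem mainTheorem6 (K : Type*) [Field K] (k : ℕ) (hk : 1 ≤ k)
    (w : ℤ → Letter) (hw : Admissible w) (π : ℤ → ℤ × ℤ) (hπ : IsPathOf w π) :
    (∃! A : Matrix ℤ ℤ (FringeField K π (k - 1)),
      IsTameSLTiling k A ∧ ExtendsFringeVars A) ∧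
    ∀ A : Matrix ℤ ℤ (FringeField K π (k - 1)),
      IsTameSLTiling k A → ExtendsFringeVars A →
        (∀ t ∈ principalMinors A π k, t ≠ 0) ∧
        ∀ i j : ℤ, A i j ∈ Subsemiring.closure
          (principalMinors A π k ∪ {u | ∃ t ∈ principalMinors A π k, u = t⁻¹}) := by
  classical
  -- The values of `X` off the fringe are irrelevant: its minors at the path do not involve them.
  let X : Matrix ℤ ℤ (FringeField K π (k - 1)) :=
    Matrix.of fun i j => if h : (i, j) ∈ fringe π (k - 1) then fringeVar K π (k - 1) ⟨_, h⟩ else 0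
  have hX : ExtendsFringeVars X := fun p => dif_pos p.2
  let D : ℤ → ℕ → FringeField K π (k - 1) := fun s m =>
    if m < k then adjMinor X m (π s).1 (π s).2 else 1
  have hD : ∀ s m, D s m ≠ 0 := by
    intro s m
    simp only [D]
    split_ifs with h
    exacts [hX.adjMinor_ne_zero hπ s (by omega), one_ne_zero]
  have hD_lt : ∀ s m, m < k → D s m = adjMinor X m (π s).1 (π s).2 := fun s m h => if_pos h
  have hDk : ∀ s m, k ≤ m → D s m = 1 := fun s m h => if_neg h.not_gt
  have hD₀ : ∀ s, D s 0 = 1 := fun s => by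
    rw [hD_lt s 0 hk]
    exact Matrix.det_isEmpty
  obtain ⟨A, hA, hAD, hAP⟩ := hπ.exists_isTameSLTiling hw hk hD hD₀ fun s => hDk s k le_rfl
  have hAX : ExtendsFringeVars A := by
    rintro ⟨p, hp⟩
    obtain ⟨s, m, hm, rfl⟩ := id hp
    rw [← hX ⟨_, hp⟩]
    -- The principal minors of `A` and of `X` of orders less than `k` coincide.
    exact hπ.eq_of_adjMinor_eq hw
      (fun s m hm => (hAD s m (by omega)).trans (hD_lt s m (by omega)))
      (fun s m hm => by rw [hAD s m (by omega)]; exact hD s m) hm s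
  have huniq : ∀ B, IsTameSLTiling k B → ExtendsFringeVars B → B = A := by
    intro B hB hBX
    refine hB.eq_of_window_eq hπ hw hk hA fun s => ?_
    ext a b
    obtain ⟨c, hc, h₁, h₂⟩ := hπ.exists_offset s a.2 b.2
    simp only [window, Matrix.of_apply]
    rw [h₁, h₂]
    -- The minors of order `k` equal one, so the arrays agree on the `k`-fringe as well.
    refine hπ.eq_of_adjMinor_eq hw (n := k) (fun s m hm => ?_)
      (fun s m hm => hBX.adjMinor_ne_zero hπ s (by omega)) hc _
    rcases hm.eq_or_lt with rfl | hm
    · rw [hB.1, hA.1]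
    · exact hBX.adjMinor_eq hπ hAX s (by omega)
  refine ⟨⟨A, ⟨hA, hAX⟩, fun B hB => huniq B hB.1 hB.2⟩, fun B hB hBX => ?_⟩
  obtain rfl := huniq B hB hBX
  refine ⟨?_, hAP _ fun s m => ?_⟩
  · rintro _ ⟨s, m, -, hm, rfl⟩
    exact hBX.adjMinor_ne_zero hπ s (by omega)
  · rcases Nat.eq_zero_or_pos m with rfl | hm
    · rw [hD₀, inv_one]
      exact ⟨one_mem _, one_mem _⟩
    rcases lt_or_ge m k with h | h
    · rw [← hAD s m h.le]
      exact ⟨Subsemiring.subset_closure (Or.inl ⟨s, m, hm, h, rfl⟩),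
        Subsemiring.subset_closure (Or.inr ⟨_, ⟨s, m, hm, h, rfl⟩, rfl⟩)⟩
    · rw [hDk s m h, inv_one]
      exact ⟨one_mem _, one_mem _⟩
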